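/- Let $n\ge 4$ be an integer, let $x_1,\dots,x_n$ be distinct positive real numbers, and let $A_n=[1+x_ix_j]_{1\le i,j\le n}$. For an integer $k$ with $2\le k\le n-2$ and real $\epsilon>0$ put $A_{n,k,\epsilon}=A_n+\epsilon R_{n,k}$, where $R_{n,k}$ is the $n\times n$ diagonal matrix whose last $k$ diagonal entries are $1$ and whose other entries are $0$. For a real positive semidefinite matrix $A=[a_{ij}]$ with non-negative entries let $S_A$ be the set of all real $\alpha\ge 0$ for which the Hadamard power $A^{\circ\alpha}=[a_{ij}^{\alpha}]$ (with $0^0=1$) is positive semidefinite (its entries are automatically non-negative). Then there is $\epsilon_0>0$, depending only on $A_n$, such that for every integer $k$ with $2\le k\le n-2$ and every $\epsilon\in(0,\epsilon_0)$ the following hold. 1. There exists $\delta>0$ such that $[\ell-\delta,\ell+\delta]\subset S_{A_{n,k,\epsilon}}$ for every integer $\ell$ with $n-k-1\le \ell\le n-3$. 2. For every integer $\ell$ with $n-k-1\le \ell\le n-3$ there exists $\alpha_\ell\in(\ell,\ell+1)$ with $\alpha_\ell\notin S_{A_{n,k,\epsilon}}$. 3. $S_{A_{n,k,\epsilon}}\cap[0,n-k-2]=\{0,1,\dots,n-k-2\}$.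 4. $S_{A_{n,k,\epsilon}}$ has at least $k$ interval components, that is, connected components that are intervals of positive length. Since $k=n-2$ is allowed and $n\ge 4$ is arbitrary, $S_A$ can thus have arbitrarily many interval components. -/

import Mathlib

namespace HadamardPower

/-- The cone of real positive semidefinite `n × n` matrices with nonnegative entries. -/
def psdNonneg (n : ℕ) : Set (Matrix (Fin n) (Fin n) ℝ) :=
  {A | A.PosSemidef ∧ ∀ i j, 0 ≤ A i j}

/-- The entrywise (Hadamard) power `[a_ij ^ α]`; the real power satisfies `0 ^ 0 = 1`. -/
noncomputable def hadamardPow {n : ℕ} (A : Matrix (Fin n) (Fin n) ℝ) (α : ℝ) :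
    Matrix (Fin n) (Fin n) ℝ :=
  Matrix.of fun i j => A i j ^ α

/-- The set of `α ≥ 0` for which the `α`-th Hadamard power of `A` is positive semidefinite
with nonnegative entries. -/
def powerSet {n : ℕ} (A : Matrix (Fin n) (Fin n) ℝ) : Set ℝ :=
  {α | 0 ≤ α ∧ hadamardPow A α ∈ psdNonneg n}

/-- The matrix `[1 + x_i x_j]`. -/
def baseMatrix {n : ℕ} (x : Fin n → ℝ) : Matrix (Fin n) (Fin n) ℝ :=
  Matrix.of fun i j => 1 + x i * x j

/-- The diagonal matrix with `1` in the last `k` diagonal entries and `0` elsewhere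
(rows are indexed by `0, …, n - 1`, so the last `k` are those with `n ≤ i + k`). -/
def lastDiag (n k : ℕ) : Matrix (Fin n) (Fin n) ℝ :=
  Matrix.diagonal fun i => if n ≤ (i : ℕ) + k then 1 else 0

/-- The perturbed matrix `[1 + x_i x_j] + ε R`, with `R` as in `lastDiag`. -/
def perturbedMatrix {n : ℕ} (x : Fin n → ℝ) (k : ℕ) (ε : ℝ) : Matrix (Fin n) (Fin n) ℝ :=
  baseMatrix x + ε • lastDiag n k

/-- The interval components of a set of reals: its connected components with more than one
point, that is, those that are intervals of positive length. -/
def intervalComponents (S : Set ℝ) : Set (Set ℝ) :=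
  {C | (∃ α ∈ S, C = connectedComponentIn S α) ∧ C.Nontrivial}

end HadamardPower

open Filter Topology Matrix

namespace HadamardPower

/-! For an integer exponent `ℓ`, the binomial theorem writes the quadratic form of the power of `[1
+ x_i x_j]` as a positively weighted sum of squares of the moments of order at most `ℓ`. The
perturbation adds positive multiples of the squares of the last `k` coordinates. A null vector is
then supported on `n - k` coordinates with `ℓ + 1` vanishing moments, so it is zero once `n - k ≤ ℓ
+ 1`. Positive definiteness is open in the exponent, which gives intervals.

For `m < α < m + 1` with `m + 3 ≤ n`, the unperturbed power is not positive semidefinite. It is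
nonsingular for every scaling of the nodes (a Chebyshev system argument), so semidefiniteness would
persist as the nodes shrink to zero, where a Taylor argument yields a negative direction. A negative
direction survives small `ε`, which separates the intervals. On the unperturbed leading block it
survives every `ε`, which leaves only integers below `n - k - 2`. -/

/-! ### Nonsingularity of powers outside the exceptional integers -/

theorem eq_zero_of_sum_mul_rpow_eq_zero (n : ℕ) : ∀ (r : ℝ), (∀ m : ℕ, m + 2 ≤ n → r ≠ m) →
    ∀ x c t : Fin n → ℝ, (∀ i, 0 < x i) → Function.Injective x → StrictMono t →
    (∀ i, 0 < t i) → (∀ i, ∑ j, c j * (1 + t i * x j) ^ r = 0) → c = 0 := by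
  induction n with
  | zero => intro r _ x c t _ _ _ _ _; exact Subsingleton.elim _ _
  | succ n ih =>
    intro r hr x c t hx hinj ht htpos h
    have hb : ∀ s : ℝ, 0 < s → ∀ j, 0 < 1 + s * x j := fun s hs j => by
      have := mul_pos hs (hx j); linarith
    -- Division makes the term `j = 0` constant. By Rolle, the `n + 1` zeros of `g` give `n` zeros
    -- of a combination of the other `n` functions with exponent `r - 1`; the factors `r * (x j - x
    -- 0)` go into the coefficients.
    let g : ℝ → ℝ := fun s => ∑ j, c j * ((1 + s * x j) / (1 + s * x 0)) ^ r
    have hg0 : ∀ i, g (t i) = 0 := by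
      intro i
      have e : g (t i) = (∑ j, c j * (1 + t i * x j) ^ r) / (1 + t i * x 0) ^ r := by
        rw [Finset.sum_div]
        refine Finset.sum_congr rfl fun j _ => ?_
        rw [Real.div_rpow (hb _ (htpos i) j).le (hb _ (htpos i) 0).le, mul_div_assoc]
      rw [e, h i, zero_div]
    have hder : ∀ s : ℝ, 0 < s → HasDerivAt g (∑ j, c j * (r * (x j - x 0) *
        (1 + s * x j) ^ (r - 1) / ((1 + s * x 0) ^ (r - 1) * (1 + s * x 0) ^ 2))) s := by
      intro s hs
      refine HasDerivAt.fun_sum fun j _ => HasDerivAt.const_mul _ ?_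
      have h1 : ∀ j, HasDerivAt (fun s : ℝ => 1 + s * x j) (x j) s := fun j => by
        simpa using ((hasDerivAt_id s).mul_const (x j)).const_add 1
      have h2 := ((h1 j).div (h1 0) (hb s hs 0).ne').rpow_const (p := r)
        (Or.inl (div_pos (hb s hs j) (hb s hs 0)).ne')
      refine h2.congr_deriv ?_
      rw [Pi.div_apply, Real.div_rpow (hb s hs j).le (hb s hs 0).le]
      have := (Real.rpow_pos_of_pos (hb s hs 0) (r - 1)).ne'
      have := (hb s hs 0).ne'
      field_simp
      ring
    have hex : ∀ i : Fin n, ∃ s ∈ Set.Ioo (t i.castSucc) (t i.succ),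
        ∑ j : Fin n, (r * (x j.succ - x 0) * c j.succ) * (1 + s * x j.succ) ^ (r - 1) = 0 := by
      intro i
      have hlt : t i.castSucc < t i.succ := ht i.castSucc_lt_succ
      obtain ⟨s, hs, hs0⟩ := exists_hasDerivAt_eq_zero (f := g) hlt
        (fun s hs => (hder s ((htpos _).trans_le hs.1)).continuousAt.continuousWithinAt)
        (by rw [hg0, hg0]) (fun s hs => hder s ((htpos _).trans hs.1))
      refine ⟨s, hs, ?_⟩
      have hspos : 0 < s := (htpos _).trans hs.1
      rw [Fin.sum_univ_succ] at hs0
      have hd : (1 + s * x 0) ^ (r - 1) * (1 + s * x 0) ^ 2 ≠ 0 :=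
        (mul_pos (Real.rpow_pos_of_pos (hb s hspos 0) _) (pow_pos (hb s hspos 0) 2)).ne'
      simp only [sub_self, mul_zero, zero_mul, zero_div, zero_add] at hs0
      have e : (∑ j : Fin n, (r * (x j.succ - x 0) * c j.succ) * (1 + s * x j.succ) ^ (r - 1))
          / ((1 + s * x 0) ^ (r - 1) * (1 + s * x 0) ^ 2) = 0 := by
        rw [← hs0, Finset.sum_div]
        refine Finset.sum_congr rfl fun j _ => ?_
        ring
      exact (div_eq_zero_iff.mp e).resolve_right hd
    choose t' ht' h0 using hex
    have hmono : StrictMono t' := by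
      intro i j hij
      exact (ht' i).2.trans_le ((ht.monotone (by
        rw [Fin.le_def]; simpa using Nat.succ_le_of_lt hij)).trans (ht' j).1.le)
    have hc := ih (r - 1) (fun m hm he => hr (m + 1) (by omega) (by push_cast; linarith))
      (fun j => x j.succ) (fun j => r * (x j.succ - x 0) * c j.succ) t' (fun j => hx _)
      (hinj.comp (Fin.succ_injective n)) hmono (fun i => (htpos _).trans (ht' i).1) h0
    have hcs : ∀ j : Fin n, c j.succ = 0 := by
      intro j
      have hr0 : r ≠ 0 := by simpa using hr 0 (by have := j.2; omega)
      have hxx : x j.succ - x 0 ≠ 0 := sub_ne_zero.mpr (hinj.ne (Fin.succ_ne_zero j))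
      have := congrFun hc j
      simpa [hr0, hxx] using this
    have h00 := h 0
    rw [Fin.sum_univ_succ] at h00
    simp only [hcs, zero_mul, Finset.sum_const_zero, add_zero] at h00
    have hc0 : c 0 = 0 :=
      (mul_eq_zero.mp h00).resolve_right (Real.rpow_pos_of_pos (hb _ (htpos 0) 0) r).ne'
    funext j
    refine Fin.cases hc0 hcs j

variable {n : ℕ}

theorem one_add_mul_pos {x : Fin n → ℝ} (hx : ∀ i, 0 < x i) (i j : Fin n) :
    0 < 1 + x i * x j := by
  have := mul_pos (hx i) (hx j); linarith

theorem mulVec_hadamardPow_baseMatrix_injective {x : Fin n → ℝ} (hx : ∀ i, 0 < x i)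
    (hinj : Function.Injective x) {r : ℝ} (hr : ∀ m : ℕ, m + 2 ≤ n → r ≠ m) {c : Fin n → ℝ}
    (h : hadamardPow (baseMatrix x) r *ᵥ c = 0) : c = 0 := by
  let σ := Tuple.sort x
  have hmono : StrictMono (x ∘ σ) :=
    (Tuple.monotone_sort x).strictMono_of_injective (hinj.comp σ.injective)
  refine eq_zero_of_sum_mul_rpow_eq_zero n r hr x c (x ∘ σ) hx hinj hmono (fun i => hx _) ?_
  intro i
  have := congrFun h (σ i)
  simpa [mulVec, dotProduct, hadamardPow, baseMatrix, mul_comm] using this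

/-! ### Failure of semidefiniteness at non-integer exponents -/

theorem dotProduct_mulVec_eq_sum (M : Matrix (Fin n) (Fin n) ℝ) (v : Fin n → ℝ) :
    v ⬝ᵥ M *ᵥ v = ∑ i, ∑ j, v i * v j * M i j := by
  simp only [dotProduct, mulVec, Finset.mul_sum]
  exact Finset.sum_congr rfl fun i _ => Finset.sum_congr rfl fun j _ => by ring

theorem sum_sum_mul_pow (x v : Fin n → ℝ) (d : ℕ) :
    ∑ i, ∑ j, v i * v j * (x i * x j) ^ d = (∑ i, v i * x i ^ d) ^ 2 := by
  rw [sq, Finset.sum_mul_sum]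
  exact Finset.sum_congr rfl fun i _ => Finset.sum_congr rfl fun j _ => by ring

/-- A vector whose first `m + 2` moments vanish while the next one does not makes the quadratic
form of the `α`-th power negative under strong contraction of the nodes, if `m < α < m + 1`. -/
theorem exists_forall_sum_neg {x v : Fin n → ℝ} (hx : ∀ i, 0 < x i) {m : ℕ} {α : ℝ}
    (h1 : (m : ℝ) < α) (h2 : α < m + 1) (hv : ∀ d ≤ m + 1, ∑ i, v i * x i ^ d = 0)
    (hv' : ∑ i, v i * x i ^ (m + 2) ≠ 0) :
    ∃ η > 0, ∀ t : ℝ, 0 < t → t < η → ∑ i, ∑ j, v i * v j * (1 + t * (x i * x j)) ^ α < 0 := by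
  let G : ℕ → ℝ → ℝ := fun d t =>
    ∑ i, ∑ j, v i * v j * (x i * x j) ^ d * (1 + t * (x i * x j)) ^ (α - d)
  have hb : ∀ t : ℝ, 0 ≤ t → ∀ i j, 0 < 1 + t * (x i * x j) := fun t ht i j => by
    have := mul_nonneg ht (mul_pos (hx i) (hx j)).le; linarith
  have hG0 : ∀ d, G d 0 = (∑ i, v i * x i ^ d) ^ 2 := fun d => by
    simp [G, ← sum_sum_mul_pow]
  have hder : ∀ d t, 0 ≤ t → HasDerivAt (G d) ((α - d) * G (d + 1) t) t := by
    intro d t ht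
    have : (α - d) * G (d + 1) t = ∑ i, ∑ j, v i * v j * (x i * x j) ^ d *
        ((x i * x j) * (α - d) * (1 + t * (x i * x j)) ^ (α - d - 1)) := by
      simp only [G, Finset.mul_sum]
      refine Finset.sum_congr rfl fun i _ => Finset.sum_congr rfl fun j _ => ?_
      rw [show α - ((d + 1 : ℕ) : ℝ) = α - d - 1 by push_cast; ring]
      ring
    rw [this]
    refine HasDerivAt.fun_sum fun i _ => HasDerivAt.fun_sum fun j _ => HasDerivAt.const_mul _ ?_
    have h1 : HasDerivAt (fun s : ℝ => 1 + s * (x i * x j)) (x i * x j) t := by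
      simpa using ((hasDerivAt_id t).mul_const (x i * x j)).const_add 1
    exact h1.rpow_const (Or.inl (hb t ht i j).ne')
  have hpos : ∀ᶠ t in 𝓝 (0 : ℝ), 0 < G (m + 2) t :=
    (hder (m + 2) 0 le_rfl).continuousAt.eventually (lt_mem_nhds (by rw [hG0]; positivity))
  obtain ⟨η, hη, hball⟩ := Metric.eventually_nhds_iff.mp hpos
  -- All `G d` with `d ≤ m + 1` vanish at `0`, and `G d` has derivative `(α - d) * G (d + 1)`. The
  -- factor is negative only at `d = m + 1`, so the sign flips once from `G (m + 2) > 0` and stays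
  -- negative down to `d = 0`.
  have key : ∀ d, d ≤ m + 1 → ∀ t, 0 < t → t < η → G d t < 0 := by
    intro d hd
    induction hd using Nat.decreasingInduction with
    | self =>
      intro t ht htη
      have hanti : StrictAntiOn (G (m + 1)) (Set.Icc 0 t) := by
        refine strictAntiOn_of_deriv_neg (convex_Icc _ _)
          (fun s hs => (hder _ s hs.1).continuousAt.continuousWithinAt) fun s hs => ?_
        rw [interior_Icc] at hs
        rw [(hder _ s hs.1.le).deriv]
        refine mul_neg_of_neg_of_pos (by push_cast; linarith) (hball ?_)
        rw [Real.dist_eq, sub_zero, abs_of_pos hs.1]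
        exact hs.2.trans htη
      have := hanti ⟨le_rfl, ht.le⟩ ⟨ht.le, le_rfl⟩ ht
      rwa [hG0, hv _ le_rfl, zero_pow two_ne_zero] at this
    | of_succ d hd ih =>
      intro t ht htη
      have hanti : StrictAntiOn (G d) (Set.Icc 0 t) := by
        refine strictAntiOn_of_deriv_neg (convex_Icc _ _)
          (fun s hs => (hder _ s hs.1).continuousAt.continuousWithinAt) fun s hs => ?_
        rw [interior_Icc] at hs
        rw [(hder _ s hs.1.le).deriv]
        have hdm : (d : ℝ) ≤ m := by exact_mod_cast Nat.lt_succ_iff.mp hd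
        exact mul_neg_of_pos_of_neg (by linarith) (ih s hs.1 (hs.2.trans htη))
      have := hanti ⟨le_rfl, ht.le⟩ ⟨ht.le, le_rfl⟩ ht
      rwa [hG0, hv _ hd.le, zero_pow two_ne_zero] at this
  refine ⟨η, hη, fun t ht htη => ?_⟩
  simpa [G] using key 0 (Nat.zero_le _) t ht htη

theorem exists_moments {x : Fin n → ℝ} (hinj : Function.Injective x) (a : Fin n → ℝ) :
    ∃ v : Fin n → ℝ, ∀ d : Fin n, ∑ i, v i * x i ^ (d : ℕ) = a d := by
  have hdet : IsUnit (vandermonde x).det := (det_vandermonde_ne_zero_iff.mpr hinj).isUnit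
  refine ⟨a ᵥ* (vandermonde x)⁻¹, fun d => ?_⟩
  have : (a ᵥ* (vandermonde x)⁻¹) ᵥ* vandermonde x = a := by
    rw [vecMul_vecMul, nonsing_inv_mul _ hdet, vecMul_one]
  simpa [vecMul, dotProduct] using congrFun this d

/-- By homogeneity, positivity on the compact unit sphere suffices, and there it persists under
small changes of the parameter. -/
theorem isOpen_setOf_posDef {X : Type*} [TopologicalSpace X]
    {M : X → Matrix (Fin n) (Fin n) ℝ} (hM : ∀ i j, Continuous fun p => M p i j)
    (hherm : ∀ p, (M p).IsHermitian) : IsOpen {p | (M p).PosDef} := by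
  rw [isOpen_iff_mem_nhds]
  intro p hp
  have hcont : Continuous fun q : X × (Fin n → ℝ) => q.2 ⬝ᵥ M q.1 *ᵥ q.2 := by
    simp only [dotProduct_mulVec_eq_sum]
    refine continuous_finsetSum _ fun i _ => continuous_finsetSum _ fun j _ => ?_
    have := (hM i j).comp (continuous_fst (X := X) (Y := Fin n → ℝ))
    have h2 : Continuous fun q : X × (Fin n → ℝ) => M q.1 i j := this
    fun_prop
  have hev : ∀ᶠ q in 𝓝 p, ∀ v ∈ Metric.sphere (0 : Fin n → ℝ) 1, 0 < v ⬝ᵥ M q *ᵥ v := by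
    refine (isCompact_sphere _ _).eventually_forall_of_forall_eventually fun v hv => ?_
    refine hcont.continuousAt.eventually (lt_mem_nhds ?_)
    have hv0 : v ≠ 0 := ne_zero_of_mem_unit_sphere ⟨v, hv⟩
    simpa using PosDef.dotProduct_mulVec_pos hp hv0
  filter_upwards [hev] with q hq
  refine PosDef.of_dotProduct_mulVec_pos (hherm q) fun v hv => ?_
  have hn : 0 < ‖v‖ := norm_pos_iff.mpr hv
  have := hq (‖v‖⁻¹ • v) (by simp [norm_smul, hn.ne'])
  rw [mulVec_smul, smul_dotProduct, dotProduct_smul, smul_eq_mul, smul_eq_mul] at this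
  have h2 := pos_of_mul_pos_right this (inv_pos.mpr hn).le
  simpa using pos_of_mul_pos_right h2 (inv_pos.mpr hn).le

theorem isHermitian_hadamardPow {A : Matrix (Fin n) (Fin n) ℝ} (hA : ∀ i j, A i j = A j i)
    (α : ℝ) : (hadamardPow A α).IsHermitian := by
  ext i j
  simp [hadamardPow, hA i j]

theorem baseMatrix_comm (x : Fin n → ℝ) (i j : Fin n) : baseMatrix x i j = baseMatrix x j i := by
  simp [baseMatrix, mul_comm]

theorem posDef_of_posSemidef_of_injective {M : Matrix (Fin n) (Fin n) ℝ} (hM : M.PosSemidef)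
    (h : ∀ c, M *ᵥ c = 0 → c = 0) : M.PosDef := by
  refine PosDef.of_dotProduct_mulVec_pos hM.1 fun v hv => ?_
  refine lt_of_le_of_ne (hM.dotProduct_mulVec_nonneg v) fun h0 => hv (h v ?_)
  exact (hM.dotProduct_mulVec_zero_iff v).mp h0.symm

/-- For `m < α < m + 1` with `m + 3 ≤ n`, the `α`-th power of `[1 + x_i x_j]` is not positive
semidefinite. -/
theorem not_posSemidef_hadamardPow_baseMatrix {x : Fin n → ℝ} (hx : ∀ i, 0 < x i)
    (hinj : Function.Injective x) {m : ℕ} (hm : m + 3 ≤ n) {α : ℝ} (h1 : (m : ℝ) < α)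
    (h2 : α < m + 1) : ¬ (hadamardPow (baseMatrix x) α).PosSemidef := by
  intro hpsd
  have hα : ∀ l : ℕ, l + 2 ≤ n → α ≠ l := by
    rintro l - rfl
    have : m < l := by exact_mod_cast h1
    have : l < m + 1 := by exact_mod_cast h2
    omega
  let M : ℝ → Matrix (Fin n) (Fin n) ℝ := fun s => hadamardPow (baseMatrix (s • x)) α
  have hMe : ∀ s i j, M s i j = (1 + s ^ 2 * (x i * x j)) ^ α := fun s i j => by
    simp only [M, hadamardPow, baseMatrix, of_apply, Pi.smul_apply, smul_eq_mul]
    congr 1; ring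
  have hbp : ∀ (s : ℝ) i j, 0 < 1 + s ^ 2 * (x i * x j) := fun s i j => by
    have := mul_nonneg (sq_nonneg s) (mul_pos (hx i) (hx j)).le; linarith
  have hMc : ∀ i j, Continuous fun s => M s i j := fun i j => by
    simp only [hMe]
    exact Continuous.rpow_const (by fun_prop) fun s => Or.inl (hbp s i j).ne'
  have hherm : ∀ s, (M s).IsHermitian := fun s =>
    isHermitian_hadamardPow (baseMatrix_comm _) α
  have hupgrade : ∀ s, 0 < s → (M s).PosSemidef → (M s).PosDef := fun s hs h =>
    posDef_of_posSemidef_of_injective h fun c hc =>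
      mulVec_hadamardPow_baseMatrix_injective (fun i => mul_pos hs (hx i))
        (fun i j hij => hinj (mul_left_cancel₀ hs.ne' hij)) hα hc
  -- The scales with a positive definite power form an open set. It is also relatively closed in
  -- `(0, ∞)`: a limit is semidefinite, hence definite by nonsingularity. Connectedness gives all
  -- scales.
  have hsub : Set.Ioi (0 : ℝ) ⊆ {s | (M s).PosDef} := by
    refine isPreconnected_Ioi.subset_of_closure_inter_subset (isOpen_setOf_posDef hMc hherm)
      ⟨1, Set.mem_Ioi.mpr one_pos, hupgrade 1 one_pos (by simpa [M] using hpsd)⟩ ?_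
    rintro s ⟨hs, hs0⟩
    refine hupgrade s hs0 (PosSemidef.of_dotProduct_mulVec_nonneg (hherm s) fun v => ?_)
    have hcl : IsClosed {s | 0 ≤ v ⬝ᵥ M s *ᵥ v} := by
      refine isClosed_le continuous_const ?_
      simp only [dotProduct_mulVec_eq_sum]
      exact continuous_finsetSum _ fun i _ => continuous_finsetSum _ fun j _ =>
        (hMc i j).const_mul _
    have := closure_minimal (fun s (hs : (M s).PosDef) => ?_) hcl hs
    · simpa using this
    · simpa using hs.posSemidef.dotProduct_mulVec_nonneg v
  -- The moment of order `m + 2` can be prescribed because `m + 3 ≤ n`.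
  obtain ⟨v, hv⟩ := exists_moments hinj fun d => if (d : ℕ) = m + 2 then 1 else 0
  obtain ⟨η, hη, hneg⟩ := exists_forall_sum_neg (v := v) hx h1 h2
    (fun d hd => by
      rw [hv ⟨d, by omega⟩, if_neg (by simp only; omega)])
    (by rw [hv ⟨m + 2, by omega⟩, if_pos rfl]; exact one_ne_zero)
  have hs : 0 < √(η / 2) := Real.sqrt_pos.mpr (by linarith)
  have hpd := (hsub hs : (M (√(η / 2))).PosDef).posSemidef.dotProduct_mulVec_nonneg v
  have hlt := hneg (η / 2) (by linarith) (by linarith)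
  rw [star_trivial, dotProduct_mulVec_eq_sum] at hpd
  simp only [hMe, Real.sq_sqrt (by linarith : (0 : ℝ) ≤ η / 2)] at hpd
  linarith

theorem exists_dotProduct_neg_of_not_posSemidef {M : Matrix (Fin n) (Fin n) ℝ}
    (hM : M.IsHermitian) (h : ¬ M.PosSemidef) : ∃ v : Fin n → ℝ, v ⬝ᵥ M *ᵥ v < 0 := by
  by_contra! hc
  exact h (PosSemidef.of_dotProduct_mulVec_nonneg hM fun v => by simpa using hc v)

/-! ### Integer exponents and the diagonal perturbation -/

theorem dotProduct_hadamardPow_baseMatrix_natCast (x v : Fin n → ℝ) (ℓ : ℕ) :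
    v ⬝ᵥ hadamardPow (baseMatrix x) ℓ *ᵥ v =
      ∑ d ∈ Finset.range (ℓ + 1), (ℓ.choose d : ℝ) * (∑ i, v i * x i ^ d) ^ 2 := by
  simp only [dotProduct_mulVec_eq_sum, ← sum_sum_mul_pow, hadamardPow, baseMatrix, of_apply,
    Real.rpow_natCast]
  simp only [add_comm (1 : ℝ), add_pow, one_pow, mul_one, Finset.mul_sum]
  rw [Finset.sum_comm' (t' := Finset.univ) (s' := fun _ => Finset.univ) (by simp)]
  rw [Finset.sum_comm]
  rw [Finset.sum_congr rfl fun i _ => Finset.sum_comm, Finset.sum_comm]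
  refine Finset.sum_congr rfl fun d _ => ?_
  rw [Finset.sum_comm]
  exact Finset.sum_congr rfl fun i _ => Finset.sum_congr rfl fun j _ => by ring

theorem perturbedMatrix_apply (x : Fin n → ℝ) (k : ℕ) (ε : ℝ) (i j : Fin n) :
    perturbedMatrix x k ε i j =
      1 + x i * x j + ε * (if i = j then (if n ≤ (i : ℕ) + k then 1 else 0) else 0) := by
  simp [perturbedMatrix, baseMatrix, lastDiag, diagonal_apply]

theorem perturbedMatrix_pos {x : Fin n → ℝ} (hx : ∀ i, 0 < x i) (k : ℕ) {ε : ℝ} (hε : 0 ≤ ε)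
    (i j : Fin n) : 0 < perturbedMatrix x k ε i j := by
  rw [perturbedMatrix_apply]
  have := one_add_mul_pos hx i j
  split_ifs <;> linarith

theorem perturbedMatrix_comm (x : Fin n → ℝ) (k : ℕ) (ε : ℝ) (i j : Fin n) :
    perturbedMatrix x k ε i j = perturbedMatrix x k ε j i := by
  rcases eq_or_ne i j with rfl | h
  · rfl
  · simp [perturbedMatrix_apply, h, h.symm, mul_comm]

theorem mem_powerSet_iff {x : Fin n → ℝ} (hx : ∀ i, 0 < x i) (k : ℕ) {ε : ℝ} (hε : 0 ≤ ε)
    (α : ℝ) : α ∈ powerSet (perturbedMatrix x k ε) ↔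
      0 ≤ α ∧ (hadamardPow (perturbedMatrix x k ε) α).PosSemidef :=
  and_congr_right fun _ => and_iff_left fun i j =>
    (Real.rpow_pos_of_pos (perturbedMatrix_pos hx k hε i j) α).le

theorem hadamardPow_perturbedMatrix (x : Fin n → ℝ) (k : ℕ) (ε α : ℝ) :
    hadamardPow (perturbedMatrix x k ε) α = hadamardPow (baseMatrix x) α +
      diagonal fun i : Fin n => if n ≤ (i : ℕ) + k then (1 + x i * x i + ε) ^ α - (1 + x i * x i) ^ α
        else 0 := by
  ext i j
  rw [Matrix.add_apply, diagonal_apply]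
  simp only [hadamardPow, of_apply, perturbedMatrix_apply, baseMatrix]
  rcases eq_or_ne i j with rfl | h
  · by_cases hk : n ≤ (i : ℕ) + k <;> simp [hk]
  · simp [h]

theorem dotProduct_diagonal_mulVec (d v : Fin n → ℝ) :
    v ⬝ᵥ diagonal d *ᵥ v = ∑ i, d i * v i ^ 2 := by
  simp only [dotProduct, mulVec_diagonal]
  exact Finset.sum_congr rfl fun i _ => by ring

theorem posSemidef_hadamardPow_perturbedMatrix_natCast {x : Fin n → ℝ} (hx : ∀ i, 0 < x i)
    (k : ℕ) {ε : ℝ} (hε : 0 ≤ ε) (ℓ : ℕ) :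
    (hadamardPow (perturbedMatrix x k ε) ℓ).PosSemidef := by
  rw [hadamardPow_perturbedMatrix]
  refine PosSemidef.add (PosSemidef.of_dotProduct_mulVec_nonneg
    (isHermitian_hadamardPow (baseMatrix_comm x) _) fun v => ?_) (PosSemidef.diagonal fun i => ?_)
  · rw [star_trivial, dotProduct_hadamardPow_baseMatrix_natCast]
    positivity
  · simp only [Pi.zero_apply]
    split_ifs
    · exact sub_nonneg.mpr (Real.rpow_le_rpow (one_add_mul_pos hx i i).le (by linarith)
        (Nat.cast_nonneg _))
    · exact le_rfl

theorem posDef_hadamardPow_perturbedMatrix_natCast {x : Fin n → ℝ} (hx : ∀ i, 0 < x i)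
    (hinj : Function.Injective x) {k : ℕ} (hk : k ≤ n) {ε : ℝ} (hε : 0 < ε) {ℓ : ℕ}
    (hℓ : 0 < ℓ) (hnk : n ≤ ℓ + k + 1) :
    (hadamardPow (perturbedMatrix x k ε) ℓ).PosDef := by
  refine posDef_of_posSemidef_of_injective
    (posSemidef_hadamardPow_perturbedMatrix_natCast hx k hε.le ℓ) fun v hv => ?_
  have hd : ∀ i, 0 < (1 + x i * x i + ε) ^ (ℓ : ℝ) - (1 + x i * x i) ^ (ℓ : ℝ) := fun i =>
    sub_pos.mpr (Real.rpow_lt_rpow (one_add_mul_pos hx i i).le (by linarith)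
      (Nat.cast_pos.mpr hℓ))
  have h0 : v ⬝ᵥ hadamardPow (perturbedMatrix x k ε) ℓ *ᵥ v = 0 := by rw [hv, dotProduct_zero]
  rw [hadamardPow_perturbedMatrix, add_mulVec, dotProduct_add,
    dotProduct_hadamardPow_baseMatrix_natCast, dotProduct_diagonal_mulVec] at h0
  have hterm : ∀ i ∈ Finset.univ, 0 ≤ (if n ≤ (i : Fin n).val + k then
      (1 + x i * x i + ε) ^ (ℓ : ℝ) - (1 + x i * x i) ^ (ℓ : ℝ) else 0) * v i ^ 2 := by
    intro i _
    refine mul_nonneg ?_ (sq_nonneg _)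
    split_ifs
    exacts [(hd i).le, le_rfl]
  have hterm' : ∀ d ∈ Finset.range (ℓ + 1),
      0 ≤ (ℓ.choose d : ℝ) * (∑ i, v i * x i ^ d) ^ 2 := fun d _ => by positivity
  obtain ⟨ha, hb⟩ := (add_eq_zero_iff_of_nonneg (Finset.sum_nonneg hterm')
    (Finset.sum_nonneg hterm)).mp h0
  rw [Finset.sum_eq_zero_iff_of_nonneg hterm] at hb
  rw [Finset.sum_eq_zero_iff_of_nonneg hterm'] at ha
  have hlast : ∀ i : Fin n, n ≤ (i : ℕ) + k → v i = 0 := fun i hi => by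
    have := hb i (Finset.mem_univ i)
    rw [if_pos hi] at this
    exact pow_eq_zero_iff two_ne_zero |>.mp ((mul_eq_zero.mp this).resolve_left (hd i).ne')
  have hmom : ∀ d ≤ ℓ, ∑ i, v i * x i ^ d = 0 := fun d hd => by
    have := ha d (Finset.mem_range.mpr (Nat.lt_succ_of_le hd))
    have hc : (ℓ.choose d : ℝ) ≠ 0 := by exact_mod_cast (Nat.choose_pos hd).ne'
    simpa [hc] using this
  -- Only `a = n - k ≤ ℓ + 1` coordinates remain, and their moments of order below `a` vanish, so
  -- Vandermonde applies.
  obtain ⟨a, rfl⟩ := Nat.exists_eq_add_of_le' hk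
  have hfirst : (fun i : Fin a => v (Fin.castAdd k i)) = 0 := by
    refine eq_zero_of_forall_pow_sum_mul_pow_eq_zero
      (hinj.comp (Fin.castAdd_injective a k)) fun d => ?_
    have := hmom d (by have := d.2; omega)
    rw [Fin.sum_univ_add] at this
    simpa [hlast (Fin.natAdd a _) (by simp)] using this
  funext i
  refine Fin.addCases (fun i => congrFun hfirst i) (fun i => ?_) i
  exact hlast _ (by simp)

/-! ### Intervals and gaps in the set of exponents -/

theorem exists_Icc_subset_powerSet {x : Fin n → ℝ} (hx : ∀ i, 0 < x i)
    (hinj : Function.Injective x) {k : ℕ} (hk : k ≤ n) {ε : ℝ} (hε : 0 < ε) {ℓ : ℕ}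
    (hℓ : 0 < ℓ) (hnk : n ≤ ℓ + k + 1) :
    ∃ δ : ℝ, 0 < δ ∧ Set.Icc ((ℓ : ℝ) - δ) (ℓ + δ) ⊆ powerSet (perturbedMatrix x k ε) := by
  have hopen : IsOpen {α : ℝ | (hadamardPow (perturbedMatrix x k ε) α).PosDef} :=
    isOpen_setOf_posDef
      (fun i j => Real.continuous_const_rpow (perturbedMatrix_pos hx k hε.le i j).ne')
      (fun α => isHermitian_hadamardPow (perturbedMatrix_comm x k ε) α)
  have hnhds : {α : ℝ | (hadamardPow (perturbedMatrix x k ε) α).PosDef} ∩ Set.Ioi 0 ∈ 𝓝 (ℓ : ℝ) :=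
    inter_mem (hopen.mem_nhds
      (posDef_hadamardPow_perturbedMatrix_natCast hx hinj hk hε hℓ hnk))
      (Ioi_mem_nhds (Nat.cast_pos.mpr hℓ))
  obtain ⟨δ, hδ, hsub⟩ := Metric.nhds_basis_closedBall.mem_iff.mp hnhds
  refine ⟨δ, hδ, ?_⟩
  rw [← Real.closedBall_eq_Icc]
  intro α hα
  have := hsub hα
  exact (mem_powerSet_iff hx k hε.le α).mpr ⟨(this.2 : 0 < α).le, PosDef.posSemidef this.1⟩

theorem eventually_not_posSemidef {x : Fin n → ℝ} (hx : ∀ i, 0 < x i)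
    (hinj : Function.Injective x) {m : ℕ} (hm : m + 3 ≤ n) {α : ℝ} (h1 : (m : ℝ) < α)
    (h2 : α < m + 1) (k : ℕ) :
    ∀ᶠ ε in 𝓝 (0 : ℝ), ¬ (hadamardPow (perturbedMatrix x k ε) α).PosSemidef := by
  obtain ⟨v, hv⟩ := exists_dotProduct_neg_of_not_posSemidef
    (isHermitian_hadamardPow (baseMatrix_comm x) α)
    (not_posSemidef_hadamardPow_baseMatrix hx hinj hm h1 h2)
  have h0 : perturbedMatrix x k 0 = baseMatrix x := by simp [perturbedMatrix]
  have hcont : ContinuousAt (fun ε => v ⬝ᵥ hadamardPow (perturbedMatrix x k ε) α *ᵥ v) 0 := by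
    simp only [dotProduct_mulVec_eq_sum, hadamardPow, of_apply]
    refine tendsto_finsetSum _ fun i _ => tendsto_finsetSum _ fun j _ =>
      Tendsto.const_mul _ ?_
    refine ContinuousAt.rpow_const ?_ (Or.inl (perturbedMatrix_pos hx k le_rfl i j).ne')
    simp only [perturbedMatrix_apply]
    fun_prop
  rw [← h0] at hv
  filter_upwards [hcont.eventually (gt_mem_nhds hv)] with ε hε hpsd
  have := hpsd.dotProduct_mulVec_nonneg v
  rw [star_trivial] at this
  exact absurd hε this.not_gt

/-- The leading block of size `n - k` is untouched by the perturbation, so its failure of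
semidefiniteness does not depend on `ε`. -/
theorem not_mem_powerSet_of_block {x : Fin n → ℝ} (hx : ∀ i, 0 < x i)
    (hinj : Function.Injective x) {k m : ℕ} (hm : m + k + 3 ≤ n) (ε : ℝ) {α : ℝ}
    (h1 : (m : ℝ) < α) (h2 : α < m + 1) : α ∉ powerSet (perturbedMatrix x k ε) := by
  rintro ⟨-, hpsd, -⟩
  obtain ⟨a, rfl⟩ := Nat.exists_eq_add_of_le' (show k ≤ n by omega)
  refine not_posSemidef_hadamardPow_baseMatrix (x := x ∘ Fin.castAdd k) (fun i => hx _)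
    (hinj.comp (Fin.castAdd_injective a k)) (m := m) (by omega) h1 h2 ?_
  convert hpsd.submatrix (Fin.castAdd k) using 1
  ext i j
  simp [hadamardPow, perturbedMatrix_apply, baseMatrix, i.2.not_ge]

theorem powerSet_inter_Icc {x : Fin n → ℝ} (hx : ∀ i, 0 < x i)
    (hinj : Function.Injective x) {k : ℕ} {ε : ℝ} (hε : 0 < ε) :
    powerSet (perturbedMatrix x k ε) ∩ Set.Icc (0 : ℝ) ((n : ℝ) - (k : ℝ) - 2) =
      {α : ℝ | ∃ m : ℕ, m + k + 2 ≤ n ∧ α = (m : ℝ)} := by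
  ext α
  constructor
  · rintro ⟨hα, h0, hle⟩
    have hfl := Nat.floor_le h0
    have hlt := Nat.lt_floor_add_one α
    have hmk : ⌊α⌋₊ + k + 2 ≤ n := by
      have : (⌊α⌋₊ : ℝ) + k + 2 ≤ n := by linarith
      exact_mod_cast this
    refine ⟨⌊α⌋₊, hmk, ?_⟩
    by_contra hne
    have hlt' : (⌊α⌋₊ : ℝ) < α := lt_of_le_of_ne hfl (Ne.symm hne)
    refine not_mem_powerSet_of_block hx hinj ?_ ε hlt' hlt hα
    have : (⌊α⌋₊ : ℝ) + k + 2 < n := by linarith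
    exact_mod_cast this
  · rintro ⟨m, hm, rfl⟩
    refine ⟨(mem_powerSet_iff hx k hε.le _).mpr ⟨Nat.cast_nonneg _,
      posSemidef_hadamardPow_perturbedMatrix_natCast hx k hε.le m⟩, Nat.cast_nonneg _, ?_⟩
    have : (m : ℝ) + k + 2 ≤ n := by exact_mod_cast hm
    linarith

/-- Intervals around `a, a + 1, …, a + k - 1` inside `S`, separated by points outside `S`, lie in
`k` different interval components. -/
theorem le_encard_intervalComponents {S : Set ℝ} {a k : ℕ}
    (hS : ∀ j < k, ∃ δ : ℝ, 0 < δ ∧ Set.Icc (((a + j : ℕ) : ℝ) - δ) ((a + j : ℕ) + δ) ⊆ S)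
    (hgap : ∀ j, j + 1 < k → ∃ α ∈ Set.Ioo ((a + j : ℕ) : ℝ) ((a + j : ℕ) + 1), α ∉ S) :
    (k : ℕ∞) ≤ (intervalComponents S).encard := by
  let C : ℕ → Set ℝ := fun j => connectedComponentIn S ((a + j : ℕ) : ℝ)
  have hmem : ∀ j < k, ((a + j : ℕ) : ℝ) ∈ S := fun j hj => by
    obtain ⟨δ, hδ, hsub⟩ := hS j hj
    exact hsub ⟨by linarith, by linarith⟩
  have hne : ∀ i j, i < j → j < k → C i ≠ C j := by
    intro i j hij hj he
    obtain ⟨α, hα, hαS⟩ := hgap i (by omega)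
    refine hαS (connectedComponentIn_subset S ((a + i : ℕ) : ℝ) ?_)
    have hord : (C i).OrdConnected := IsPreconnected.ordConnected isPreconnected_connectedComponentIn
    refine hord.out (mem_connectedComponentIn (hmem i (hij.trans hj)))
      (he.symm.subset (mem_connectedComponentIn (hmem j hj))) ⟨hα.1.le, hα.2.le.trans ?_⟩
    have : a + i + 1 ≤ a + j := by omega
    exact_mod_cast this
  have hinj : Set.InjOn C (Finset.range k : Set ℕ) := by
    intro i hi j hj he
    simp only [Finset.coe_range, Set.mem_Iio] at hi hj
    rcases lt_trichotomy i j with h | h | h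
    · exact absurd he (hne i j h hj)
    · exact h
    · exact absurd he.symm (hne j i h hi)
  have himg : C '' (Finset.range k : Set ℕ) ⊆ intervalComponents S := by
    rintro _ ⟨j, hj, rfl⟩
    simp only [Finset.coe_range, Set.mem_Iio] at hj
    obtain ⟨δ, hδ, hsub⟩ := hS j hj
    have hIcc := isPreconnected_Icc.subset_connectedComponentIn
      (x := ((a + j : ℕ) : ℝ)) ⟨by linarith, by linarith⟩ hsub
    exact ⟨⟨_, hmem j hj, rfl⟩, _, hIcc ⟨by linarith, by linarith⟩, _,
      hIcc (Set.right_mem_Icc.mpr (by linarith)), (by linarith : ((a + j : ℕ) : ℝ) < _).ne⟩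
  calc (k : ℕ∞) = (Finset.range k : Set ℕ).encard := by rw [Set.encard_coe_eq_coe_finsetCard, Finset.card_range]
    _ = (C '' (Finset.range k : Set ℕ)).encard := hinj.encard_image.symm
    _ ≤ _ := Set.encard_le_encard himg

end HadamardPower

theorem theorem1p1 (n : ℕ) (hn : 4 ≤ n) (x : Fin n → ℝ) (hpos : ∀ i, 0 < x i)
    (hdist : Function.Injective x) :
    ∃ ε₀ : ℝ, 0 < ε₀ ∧ ∀ k : ℕ, 2 ≤ k → k + 2 ≤ n → ∀ ε : ℝ, 0 < ε → ε < ε₀ →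
      (∃ δ : ℝ, 0 < δ ∧ ∀ ℓ : ℕ, n ≤ ℓ + k + 1 → ℓ + 3 ≤ n →
        Set.Icc ((ℓ : ℝ) - δ) ((ℓ : ℝ) + δ) ⊆
          HadamardPower.powerSet (HadamardPower.perturbedMatrix x k ε)) ∧
      (∀ ℓ : ℕ, n ≤ ℓ + k + 1 → ℓ + 3 ≤ n →
        ∃ α ∈ Set.Ioo (ℓ : ℝ) ((ℓ : ℝ) + 1),
          α ∉ HadamardPower.powerSet (HadamardPower.perturbedMatrix x k ε)) ∧
      HadamardPower.powerSet (HadamardPower.perturbedMatrix x k ε) ∩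
          Set.Icc (0 : ℝ) ((n : ℝ) - (k : ℝ) - 2) =
        {α : ℝ | ∃ m : ℕ, m + k + 2 ≤ n ∧ α = (m : ℝ)} ∧
      (k : ℕ∞) ≤ (HadamardPower.intervalComponents
        (HadamardPower.powerSet (HadamardPower.perturbedMatrix x k ε))).encard := by
  -- Testing only the midpoints `ℓ + 1 / 2` leaves finitely many pairs `(k, ℓ)`, so one `ε₀` serves
  -- every `k`.
  have hev : ∀ᶠ ε in 𝓝 (0 : ℝ), ∀ k ∈ Finset.range n, ∀ ℓ ∈ Finset.range (n - 2),
      ¬ (HadamardPower.hadamardPow (HadamardPower.perturbedMatrix x k ε)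
        ((ℓ : ℝ) + 1 / 2)).PosSemidef := by
    refine (Filter.eventually_all_finset _).mpr fun k _ =>
      (Filter.eventually_all_finset _).mpr fun ℓ hℓ => ?_
    rw [Finset.mem_range] at hℓ
    exact HadamardPower.eventually_not_posSemidef hpos hdist (m := ℓ) (by omega) (by linarith)
      (by linarith) k
  obtain ⟨ε₀, hε₀, hball⟩ := Metric.eventually_nhds_iff.mp hev
  refine ⟨ε₀, hε₀, fun k hk2 hkn ε hε hεlt => ?_⟩
  have hgap : ∀ ℓ : ℕ, n ≤ ℓ + k + 1 → ℓ + 3 ≤ n → ∃ α ∈ Set.Ioo (ℓ : ℝ) ((ℓ : ℝ) + 1),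
      α ∉ HadamardPower.powerSet (HadamardPower.perturbedMatrix x k ε) := by
    intro ℓ _ hℓ
    refine ⟨(ℓ : ℝ) + 1 / 2, ⟨by linarith, by linarith⟩, fun hmem => ?_⟩
    refine hball ?_ k (Finset.mem_range.mpr (by omega)) ℓ (Finset.mem_range.mpr (by omega))
      hmem.2.1
    rwa [Real.dist_eq, sub_zero, abs_of_pos hε]
  have hnear : ∀ ℓ : ℕ, n ≤ ℓ + k + 1 → ∃ δ : ℝ, 0 < δ ∧ Set.Icc ((ℓ : ℝ) - δ) (ℓ + δ) ⊆
      HadamardPower.powerSet (HadamardPower.perturbedMatrix x k ε) := fun ℓ hℓ =>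
    HadamardPower.exists_Icc_subset_powerSet hpos hdist (by omega) hε (by omega) hℓ
  refine ⟨?_, hgap, HadamardPower.powerSet_inter_Icc hpos hdist hε, ?_⟩
  · have hunif : ∀ᶠ δ in 𝓝[>] (0 : ℝ), ∀ ℓ ∈ Finset.range n, n ≤ ℓ + k + 1 →
        Set.Icc ((ℓ : ℝ) - δ) (ℓ + δ) ⊆
          HadamardPower.powerSet (HadamardPower.perturbedMatrix x k ε) := by
      refine (Filter.eventually_all_finset _).mpr fun ℓ _ => ?_
      by_cases hℓ : n ≤ ℓ + k + 1
      · obtain ⟨δ, hδ, hsub⟩ := hnear ℓ hℓ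
        filter_upwards [Ioo_mem_nhdsGT hδ] with δ' hδ' _
        exact (Set.Icc_subset_Icc (by linarith [hδ'.2]) (by linarith [hδ'.2])).trans hsub
      · exact Eventually.of_forall fun _ h => absurd h hℓ
    obtain ⟨δ, hδ, hδpos⟩ := (hunif.and self_mem_nhdsWithin).exists
    exact ⟨δ, hδpos, fun ℓ h1 h2 => hδ ℓ (Finset.mem_range.mpr (by omega)) h1⟩
  -- The `k` centres are `n - k - 1, …, n - 2`. The last one lies beyond the range of the first
  -- claim, but `hnear` covers it, and only the `k - 1` gaps between centres are needed.
  · exact HadamardPower.le_encard_intervalComponents (a := n - k - 1)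
      (fun j _ => hnear _ (by omega)) (fun j hj => hgap _ (by omega) (by omega))
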